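/- For words $w=w_1\cdots w_s$ and $v=v_1\cdots v_r$ with positive integer letters, say that $w$ contains the pattern $v$ if there are indices $1\le t_1<\cdots<t_r\le s$ such that for all $1\le i,j\le r$ we have $w_{t_i}\le w_{t_j}$ if and only if $v_i\le v_j$; otherwise $w$ avoids $v$. Let $[k]=\{1,\dots,k\}$, and let $[k]^n(v)$ be the set of words of length $n$ with letters in $[k]$ that avoid $v$. A sequence $f(n)$, $n\ge 0$, is called P-recursive if there are an integer $N\ge 0$ and polynomials $P_0,\dots,P_N$, not all zero, such that $\sum_{i=0}^N P_i(n)f(n+i)=0$ for all integers $n\ge 0$. Theorem. Let $\sigma$ be a permutation pattern of length $3$ (that is, $\sigma\in\{123,132,213,231,312,321\}$), and let $f(n)=|[n]^n(\sigma)|$ for $n\ge 0$ (so $f(0)=1$). Then the sequence $f$ is P-recursive, with polynomials $P_i\in\mathbb{Q}[x]$, and it satisfies the three-term recurrence $$p(n)f(n-2)+q(n)f(n-1)+r(n)f(n)=0\qquad\text{for all integers } n\ge 3,$$ where $$p(n)=3(n-3)(n-1)(3n-5)(3n-4)(5n-4),$$ $$q(n)=288-1440n+2780n^2-2435n^3+976n^4-145n^5,$$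 $$r(n)=2(n-2)^2n(n+1)(5n-9).$$ -/

import Mathlib

namespace WordPattern

/-- `Word n k` is the set of words of length `n` with letters in an ordered alphabet of `k`
letters; the letters `1, …, k` are represented by `0, …, k - 1`. -/
abbrev Word (n k : ℕ) : Type := Fin n → Fin k

/-- The word `w` contains the pattern `v`: some subsequence of `w` is order-isomorphic to `v`. -/
def Contains {s k r m : ℕ} (w : Word s k) (v : Word r m) : Prop :=
  ∃ t : Fin r → Fin s, StrictMono t ∧ ∀ i j : Fin r, w (t i) ≤ w (t j) ↔ v i ≤ v j

/-- The set of words of length `n` on `k` letters that avoid the pattern `v`. -/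
def avoiders (n k : ℕ) {r m : ℕ} (v : Word r m) : Set (Word n k) :=
  {w | ¬ Contains w v}

/-- The diagonal sequence: the number of words of length `n` on `n` letters avoiding `v`. -/
noncomputable def diagonalCount {r m : ℕ} (v : Word r m) (n : ℕ) : ℕ :=
  (avoiders n n v).ncard

/-- A sequence is polynomially recursive if it satisfies, for all `n ≥ 0`, a linear recurrence of
finite order whose coefficients are polynomials in `n`, not all of them zero. -/
def IsPRecursive {K : Type*} [Field K] (f : ℕ → K) : Prop :=
  ∃ (N : ℕ) (P : Fin (N + 1) → Polynomial K), (∃ i, P i ≠ 0) ∧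
    ∀ n : ℕ, ∑ i, (P i).eval (n : K) * f (n + (i : ℕ)) = 0

end WordPattern

/-! Read a word letter by letter and keep its running minimum. Whether a later letter completes 123
(or 132) depends only on which letters above that minimum are still allowed. If there are `h` of
these, the choices among them leave 1, …, h allowed letters, once each, for both patterns. So both
have the generating tree `treeCount`, and reversal and complement reach the other four patterns
(`ncard_avoiders_perm`).

The tree recurrence has an explicit solution built from the Catalan series at x(1-x)/(1-u), where x
marks length and u the first label (`treeCount_eq_coeff`). Its coefficients are single
hypergeometric sums (`treeCount_zero_right`). On the diagonal, creative telescoping applies: the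
recurrence operator turns the summand into H(j+1) - H(j), with H zero at both ends
(`treeCount_diagonal_recurrence`). -/

namespace WordPattern

/-! ### The generating tree for 123 and 132 -/

/-- The words that may be read from a state with `m` letters that are at most the running minimum
and with the set `S` of admissible letters above it, when no letter `a` may be followed by letters
`b`, `c` greater than `a` with `bad b c`. -/
def Admissible (bad : ℕ → ℕ → Prop) {n : ℕ} (m : ℕ) (S : Finset ℕ) (w : Fin n → ℕ) : Prop :=
  (∀ i, w i < m ∨ w i ∈ S) ∧
  (∀ i j, i < j → m ≤ w i → m ≤ w j → ¬ bad (w i) (w j)) ∧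
  ∀ i j l, i < j → j < l → w i < w j → w i < w l → ¬ bad (w j) (w l)

/-- The number of nodes at depth `n` below a node labelled `(m, h)` of the generating tree of the
words that avoid a pattern of length three. -/
def treeCount : ℕ → ℕ → ℕ → ℕ
  | 0, _, _ => 1
  | n + 1, m, h => ∑ a ∈ Finset.range m, treeCount n (a + 1) (h + (m - 1 - a)) +
      ∑ i ∈ Finset.range h, treeCount n m (i + 1)

/-- The letter `a` becomes the running minimum, so the letters from `a + 1` to `m - 1` now lie above
it and become admissible. -/
lemma admissible_cons_of_lt {bad : ℕ → ℕ → Prop} {n m a : ℕ} {S : Finset ℕ} {w : Fin n → ℕ}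
    (ha : a < m) :
    Admissible bad m S (Fin.cons a w : Fin (n + 1) → ℕ) ↔
      Admissible bad (a + 1) (S ∪ Finset.Ico (a + 1) m) w := by
  simp only [Admissible, Fin.forall_fin_succ, Fin.cons_zero, Fin.cons_succ, Fin.succ_lt_succ_iff,
    Finset.mem_union, Finset.mem_Ico, Fin.succ_pos, Fin.not_lt_zero, false_imp_iff,
    true_imp_iff, implies_true, true_and]
  constructor
  · rintro ⟨⟨-, h1⟩, ⟨-, h2⟩, h3, h4⟩
    refine ⟨fun i => ?_, fun i j hij hi hj => h3 i j hij hi hj, h4⟩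
    rcases h1 i with h | h
    · omega
    · exact Or.inr (Or.inl h)
  · rintro ⟨h1, h2, h3⟩
    refine ⟨⟨Or.inl ha, fun i => ?_⟩, ⟨fun j hm => by omega, fun i j hij hi hj =>
      h2 i j hij (by omega) (by omega)⟩, fun i j hij hi hj => h2 i j hij hi hj, h3⟩
    rcases h1 i with h | h | h
    · omega
    · exact Or.inr h
    · omega

/-- Triples starting at `a` need no separate condition: their last two letters also exceed the
running minimum, so the pair condition already excludes them. -/
lemma admissible_cons_of_le {bad : ℕ → ℕ → Prop} [∀ b, DecidablePred (bad b)] {n m a : ℕ}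
    {S : Finset ℕ} {w : Fin n → ℕ} (hS : ∀ b ∈ S, m ≤ b) (ha : a ∈ S) :
    Admissible bad m S (Fin.cons a w : Fin (n + 1) → ℕ) ↔
      Admissible bad m {b ∈ S | ¬ bad a b} w := by
  have hma := hS a ha
  simp only [Admissible, Fin.forall_fin_succ, Fin.cons_zero, Fin.cons_succ, Fin.succ_lt_succ_iff,
    Finset.mem_filter, Fin.succ_pos, Fin.not_lt_zero, false_imp_iff,
    true_imp_iff, implies_true, true_and]
  constructor
  · rintro ⟨⟨-, h1⟩, ⟨h5, h2⟩, h3, h4⟩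
    refine ⟨fun i => ?_, h2, h4⟩
    rcases h1 i with h | h
    · exact Or.inl h
    · exact Or.inr ⟨h, h5 i hma (hS _ h)⟩
  · rintro ⟨h1, h2, h3⟩
    refine ⟨⟨Or.inr ha, fun i => (h1 i).imp_right And.left⟩, ⟨fun j _ hj => ?_, h2⟩,
      fun i j hij hi hj => h2 i j hij (by omega) (by omega), h3⟩
    rcases h1 j with h | h
    · omega
    · exact h.2

lemma finite_setOf_admissible (bad : ℕ → ℕ → Prop) (n m : ℕ) (S : Finset ℕ) :
    {w : Fin n → ℕ | Admissible bad m S w}.Finite := by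
  refine (Set.Finite.pi' (t := fun _ : Fin n => (↑(Finset.range m ∪ S) : Set ℕ))
    fun _ => Finset.finite_toSet _).subset fun w hw i => ?_
  have := hw.1 i
  simpa using this

/-- Counting words by their first letter. -/
lemma ncard_eq_sum_cons {n : ℕ} (A : Finset ℕ) (P : (Fin (n + 1) → ℕ) → Prop)
    (hA : ∀ w, P w → w 0 ∈ A) (hP : {w | P w}.Finite) :
    {w | P w}.ncard = ∑ a ∈ A, {w : Fin n → ℕ | P (Fin.cons a w)}.ncard := by
  have hfin (a : ℕ) : {w : Fin n → ℕ | P (Fin.cons a w)}.Finite :=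
    hP.preimage (f := fun w : Fin n → ℕ => (Fin.cons a w : Fin (n + 1) → ℕ))
      (Fin.cons_right_injective (α := fun _ => ℕ) a).injOn
  have (a : A) : Finite {w : Fin n → ℕ | P (Fin.cons (a : ℕ) w)} := hfin a
  have e : {w | P w} ≃ Σ a : A, {w : Fin n → ℕ | P (Fin.cons (a : ℕ) w)} :=
    { toFun := fun w => ⟨⟨w.1 0, hA _ w.2⟩, ⟨Fin.tail w.1, by
        simpa only [Set.mem_ofPred_eq, Fin.cons_self_tail] using w.2⟩⟩
      invFun := fun p => ⟨Fin.cons (p.1 : ℕ) p.2.1, p.2.2⟩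
      left_inv := fun w => Subtype.ext (Fin.cons_self_tail _)
      right_inv := fun p => rfl }
  rw [← Nat.card_coe_set_eq, Nat.card_congr e, Nat.card_sigma, ← Finset.sum_coe_sort A]
  rfl

/-- In both cases `bad = (<)` and `bad = (>)`, the hypothesis `hbad` holds: the number of
letters of a set that remain admissible takes each possible value once. -/
lemma ncard_admissible (bad : ℕ → ℕ → Prop) [∀ b, DecidablePred (bad b)]
    (hbad : ∀ (S : Finset ℕ) (g : ℕ → ℕ),
      ∑ a ∈ S, g (Finset.card {b ∈ S | ¬ bad a b}) = ∑ i ∈ Finset.range S.card, g (i + 1))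
    (n m : ℕ) (S : Finset ℕ) (hS : ∀ b ∈ S, m ≤ b) :
    {w : Fin n → ℕ | Admissible bad m S w}.ncard = treeCount n m S.card := by
  induction n generalizing m S with
  | zero =>
    have : {w : Fin 0 → ℕ | Admissible bad m S w} = {Fin.elim0} := by
      ext w
      simp [Admissible, Subsingleton.elim w Fin.elim0]
    rw [this, Set.ncard_singleton, treeCount]
  | succ n ih =>
    have hdisj : Disjoint (Finset.range m) S := by
      rw [Finset.disjoint_left]
      intro a ha haS
      have := hS a haS
      have := Finset.mem_range.1 ha
      omega
    rw [ncard_eq_sum_cons (Finset.range m ∪ S) _ (fun w hw => by simpa using hw.1 0)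
      (finite_setOf_admissible _ _ _ _), Finset.sum_union hdisj, treeCount,
      ← hbad S fun c => treeCount n m c]
    congr 1
    · refine Finset.sum_congr rfl fun a ha => ?_
      have ha := Finset.mem_range.1 ha
      simp only [admissible_cons_of_lt ha]
      rw [ih, Finset.card_union_of_disjoint, Nat.card_Ico]
      · congr 1
        omega
      · rw [Finset.disjoint_left]
        intro b hb hb'
        have := hS b hb
        have := Finset.mem_Ico.1 hb'
        omega
      · intro b hb
        rcases Finset.mem_union.1 hb with h | h
        · have := hS b h
          omega
        · exact (Finset.mem_Ico.1 h).1
    · refine Finset.sum_congr rfl fun a ha => ?_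
      simp only [admissible_cons_of_le hS ha]
      exact ih _ _ fun b hb => hS b (Finset.mem_filter.1 hb).1

/-- The r-th smallest letter leaves exactly the r smallest ones. In the induction a new maximum
keeps the whole set and does not affect the other counts. -/
lemma sum_card_filter_not_lt (S : Finset ℕ) (g : ℕ → ℕ) :
    ∑ a ∈ S, g (Finset.card {b ∈ S | ¬ a < b}) = ∑ i ∈ Finset.range S.card, g (i + 1) := by
  induction S using Finset.induction_on_max with
  | empty => simp
  | insert a s h ih =>
    have ha : a ∉ s := fun h' => lt_irrefl _ (h a h')
    rw [Finset.sum_insert ha, Finset.card_insert_of_notMem ha, Finset.sum_range_succ, add_comm,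
      ← ih]
    congr 1
    · refine Finset.sum_congr rfl fun b hb => ?_
      rw [Finset.filter_insert, if_neg (not_not.2 (h b hb))]
    · rw [Finset.filter_true_of_mem, Finset.card_insert_of_notMem ha]
      intro b hb
      rcases Finset.mem_insert.1 hb with rfl | hb
      · exact lt_irrefl _
      · exact (h b hb).le.not_gt

lemma sum_card_filter_not_gt (S : Finset ℕ) (g : ℕ → ℕ) :
    ∑ a ∈ S, g (Finset.card {b ∈ S | ¬ b < a}) = ∑ i ∈ Finset.range S.card, g (i + 1) := by
  induction S using Finset.induction_on_min with
  | empty => simp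
  | insert a s h ih =>
    have ha : a ∉ s := fun h' => lt_irrefl _ (h a h')
    rw [Finset.sum_insert ha, Finset.card_insert_of_notMem ha, Finset.sum_range_succ, add_comm,
      ← ih]
    congr 1
    · refine Finset.sum_congr rfl fun b hb => ?_
      rw [Finset.filter_insert, if_neg (not_not.2 (h b hb))]
    · rw [Finset.filter_true_of_mem, Finset.card_insert_of_notMem ha]
      intro b hb
      rcases Finset.mem_insert.1 hb with rfl | hb
      · exact lt_irrefl _
      · exact (h b hb).le.not_gt

/-- If containing `v` means containing a letter `a` followed by letters `b`, `c` greater than `a`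
with `bad b c`, then the words that avoid `v` are counted by the generating tree. -/
lemma ncard_avoiders_eq_treeCount (bad : ℕ → ℕ → Prop) [∀ b, DecidablePred (bad b)]
    (hbad : ∀ (S : Finset ℕ) (g : ℕ → ℕ),
      ∑ a ∈ S, g (Finset.card {b ∈ S | ¬ bad a b}) = ∑ i ∈ Finset.range S.card, g (i + 1))
    {r s : ℕ} (v : Word r s)
    (hv : ∀ {n k : ℕ} (w : Word n k), Contains w v ↔ ∃ i j l, i < j ∧ j < l ∧
      w i < w j ∧ w i < w l ∧ bad (w j) (w l)) (n k : ℕ) :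
    (avoiders n k v).ncard = treeCount n k 0 := by
  rw [← Finset.card_empty, ← ncard_admissible bad hbad n k ∅ (by simp)]
  refine Set.ncard_congr (fun w _ i => (w i : ℕ)) ?_ ?_ ?_
  · intro w hw
    refine ⟨fun i => Or.inl (w i).2, fun i j _ hi => absurd (w i).2 (not_lt.2 hi),
      fun i j l hij hjl h1 h2 h3 => hw ((hv w).2 ⟨i, j, l, hij, hjl, h1, h2, h3⟩)⟩
  · intro w w' _ _ h
    funext i
    exact Fin.ext (congrFun h i)
  · intro w hw
    have hk (i) : w i < k := by simpa using hw.1 i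
    refine ⟨fun i => ⟨w i, hk i⟩, fun h => ?_, rfl⟩
    obtain ⟨i, j, l, hij, hjl, h1, h2, h3⟩ := (hv _).1 h
    exact hw.2.2 i j l hij hjl h1 h2 h3

/-! ### Reversal and complement -/

lemma contains_comp_rev {s k r m : ℕ} (w : Word s k) (v : Word r m) (h : Contains w v) :
    Contains (w ∘ Fin.rev) (v ∘ Fin.rev) := by
  obtain ⟨t, ht, h⟩ := h
  refine ⟨fun i => (t i.rev).rev, fun i j hij => ?_, fun i j => ?_⟩
  · exact Fin.rev_lt_rev.2 (ht (Fin.rev_lt_rev.2 hij))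
  · simp [h]

lemma contains_rev_comp {s k r m : ℕ} (w : Word s k) (v : Word r m) (h : Contains w v) :
    Contains (Fin.rev ∘ w) (Fin.rev ∘ v) := by
  obtain ⟨t, ht, h⟩ := h
  exact ⟨t, ht, fun i j => by simp [Fin.rev_le_rev, h]⟩

lemma comp_rev_comp_rev {s k : ℕ} (w : Word s k) : (w ∘ Fin.rev) ∘ Fin.rev = w := by
  funext i
  simp

lemma rev_comp_rev_comp {s k : ℕ} (w : Word s k) : Fin.rev ∘ (Fin.rev ∘ w) = w := by
  funext i
  simp

lemma ncard_avoiders_comp_rev (n k : ℕ) {r m : ℕ} (v : Word r m) :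
    (avoiders n k (v ∘ Fin.rev)).ncard = (avoiders n k v).ncard := by
  refine Set.ncard_congr (fun w _ => w ∘ Fin.rev) ?_ ?_ ?_
  · intro w hw h
    have := contains_comp_rev _ _ h
    rw [comp_rev_comp_rev] at this
    exact hw this
  · intro w w' _ _ h
    rw [← comp_rev_comp_rev w, h, comp_rev_comp_rev]
  · intro w hw
    refine ⟨w ∘ Fin.rev, fun h => hw ?_, comp_rev_comp_rev w⟩
    have := contains_comp_rev _ _ h
    rwa [comp_rev_comp_rev, comp_rev_comp_rev] at this

lemma ncard_avoiders_rev_comp (n k : ℕ) {r m : ℕ} (v : Word r m) :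
    (avoiders n k (Fin.rev ∘ v)).ncard = (avoiders n k v).ncard := by
  refine Set.ncard_congr (fun w _ => Fin.rev ∘ w) ?_ ?_ ?_
  · intro w hw h
    have := contains_rev_comp _ _ h
    rw [rev_comp_rev_comp] at this
    exact hw this
  · intro w w' _ _ h
    rw [← rev_comp_rev_comp w, h, rev_comp_rev_comp]
  · intro w hw
    refine ⟨Fin.rev ∘ w, fun h => hw ?_, rev_comp_rev_comp w⟩
    have := contains_rev_comp _ _ h
    rwa [rev_comp_rev_comp, rev_comp_rev_comp] at this

lemma contains_fin_three {s k m : ℕ} (w : Word s k) (v : Word 3 m) :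
    Contains w v ↔ ∃ i j l, i < j ∧ j < l ∧
      ∀ a b : Fin 3, ![w i, w j, w l] a ≤ ![w i, w j, w l] b ↔ v a ≤ v b := by
  constructor
  · rintro ⟨t, ht, h⟩
    refine ⟨t 0, t 1, t 2, ht (by decide), ht (by decide), ?_⟩
    have : ![w (t 0), w (t 1), w (t 2)] = w ∘ t := by
      funext i
      fin_cases i <;> rfl
    rw [this]
    exact h
  · rintro ⟨i, j, l, hij, hjl, h⟩
    refine ⟨![i, j, l], ?_, ?_⟩
    · intro a b hab
      fin_cases a <;> fin_cases b <;> simp_all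
      exact hij.trans hjl
    · have : w ∘ ![i, j, l] = ![w i, w j, w l] := by
        funext i
        fin_cases i <;> rfl
      simp_rw [← this] at h
      exact h

lemma ncard_avoiders_increasing (n k : ℕ) :
    (avoiders n k (![0, 1, 2] : Word 3 3)).ncard = treeCount n k 0 := by
  refine ncard_avoiders_eq_treeCount (· < ·) sum_card_filter_not_lt _ (fun w => ?_) n k
  rw [contains_fin_three]
  refine exists_congr fun i => exists_congr fun j => exists_congr fun l =>
    and_congr_right fun _ => and_congr_right fun _ => ?_
  simp only [Fin.forall_fin_succ, Fin.lt_def, Fin.le_def]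
  simp
  omega

lemma ncard_avoiders_zero_two_one (n k : ℕ) :
    (avoiders n k (![0, 2, 1] : Word 3 3)).ncard = treeCount n k 0 := by
  refine ncard_avoiders_eq_treeCount (fun a b => b < a) sum_card_filter_not_gt _ (fun w => ?_) n k
  rw [contains_fin_three]
  refine exists_congr fun i => exists_congr fun j => exists_congr fun l =>
    and_congr_right fun _ => and_congr_right fun _ => ?_
  simp only [Fin.forall_fin_succ, Fin.lt_def, Fin.le_def]
  simp
  omega

/-- All permutation patterns of length three are avoided by equally many words. -/
theorem ncard_avoiders_perm (σ : Equiv.Perm (Fin 3)) (n k : ℕ) :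
    (avoiders n k (⇑σ)).ncard = treeCount n k 0 := by
  -- The two orbits are {123, 321} and the other four patterns.
  have key : ∀ σ : Equiv.Perm (Fin 3),
      ∃ v : Word 3 3, (v = ![0, 1, 2] ∨ v = ![0, 2, 1]) ∧
        (⇑σ = v ∨ ⇑σ = v ∘ Fin.rev ∨ ⇑σ = Fin.rev ∘ v ∨ ⇑σ = Fin.rev ∘ (v ∘ Fin.rev)) := by
    decide
  obtain ⟨v, hv, h⟩ := key σ
  have hv' : (avoiders n k v).ncard = treeCount n k 0 := by
    rcases hv with rfl | rfl
    exacts [ncard_avoiders_increasing n k, ncard_avoiders_zero_two_one n k]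
  rcases h with h | h | h | h <;> rw [h] <;>
    simp only [ncard_avoiders_comp_rev, ncard_avoiders_rev_comp, hv']

end WordPattern

/-! ### Solving the tree recurrence by power series -/

namespace WordPattern

open PowerSeries

lemma coeff_one_sub_X_pow (R : Type*) [CommRing R] (j i : ℕ) :
    coeff i ((1 - X : R⟦X⟧) ^ j) = (-1) ^ i * (j.choose i : R) := by
  induction j generalizing i with
  | zero => cases i <;> simp [coeff_one]
  | succ j ih =>
    rw [pow_succ, mul_sub, mul_one, map_sub, ih]
    cases i with
    | zero => simp
    | succ i =>
      rw [coeff_succ_mul_X, ih, Nat.choose_succ_succ]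
      push_cast
      ring

/-- The bivariate series `C(x(1-x)/(1-u))`, where `C` is the Catalan series. The outer variable is
`x`, and the inner one is `u`. -/
lemma exists_catalan_comp : ∃ U : ℤ⟦X⟧⟦X⟧, (1 - C X) * (U - 1) = X * (1 - X) * U ^ 2 ∧
    ∀ n, coeff n U = ∑ j ∈ Finset.range (n + 1),
      ((catalan j * ((-1) ^ (n - j) * j.choose (n - j)) : ℤ) : ℤ⟦X⟧) * (mk 1) ^ j := by
  set E : ℤ⟦X⟧ := mk 1 with hE
  have hE1 : E * (1 - X) = 1 := mk_one_mul_one_sub_eq_one ℤ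
  set t : ℤ⟦X⟧⟦X⟧ := X * (1 - X) * C E with ht
  have hsub : HasSubst t := HasSubst.of_constantCoeff_zero' (by simp [ht])
  set c : ℤ⟦X⟧ := PowerSeries.map (Nat.castRingHom ℤ) catalanSeries with hc
  have hc1 : c ^ 2 * X + 1 = c := by
    rw [hc, ← map_X (Nat.castRingHom ℤ), ← map_pow, ← map_mul,
      ← map_one (PowerSeries.map (Nat.castRingHom ℤ)), ← map_add, catalanSeries_sq_mul_X_add_one]
  refine ⟨substAlgHom hsub c, ?_, fun n => ?_⟩
  · have h := congrArg (substAlgHom hsub) hc1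
    rw [map_add, map_mul, map_pow, map_one, substAlgHom_X] at h
    have hCE : C E * (1 - C X) = (1 : ℤ⟦X⟧⟦X⟧) := by
      rw [← map_one C, ← map_sub, ← map_mul, hE1]
    set U : ℤ⟦X⟧⟦X⟧ := substAlgHom hsub c
    calc (1 - C X) * (U - 1) = (1 - C X) * (U ^ 2 * t) := by rw [← h, add_sub_cancel_right, h]
      _ = X * (1 - X) * U ^ 2 * (C E * (1 - C X)) := by rw [ht]; ring
      _ = _ := by rw [hCE, mul_one]
  · have hpow (j : ℕ) : coeff n (t ^ j) =
        if j ≤ n then (((-1) ^ (n - j) * j.choose (n - j) : ℤ) : ℤ⟦X⟧) * E ^ j else 0 := by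
      rw [ht, mul_pow, mul_pow, ← map_pow, coeff_mul_C, coeff_X_pow_mul']
      split_ifs
      · rw [coeff_one_sub_X_pow]
        push_cast
        rfl
      · rw [zero_mul]
    rw [coe_substAlgHom, coeff_subst' hsub,
      finsum_eq_sum_of_support_subset (s := Finset.range (n + 1))]
    · refine Finset.sum_congr rfl fun j hj => ?_
      rw [hpow, if_pos (Nat.lt_succ_iff.1 (Finset.mem_range.1 hj)), hc, coeff_map,
        catalanSeries_coeff, Algebra.smul_def, ← mul_assoc]
      simp
    · intro j hj
      rw [Function.mem_support, hpow] at hj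
      by_contra h
      rw [Finset.coe_range, Set.mem_Iio, not_lt] at h
      exact hj (by rw [if_neg (by omega), Algebra.smul_def, mul_zero])

lemma isUnit_of_constantCoeff_eq_one {R : Type*} [CommRing R] {f : R⟦X⟧}
    (h : constantCoeff f = 1) : IsUnit f :=
  isUnit_iff_constantCoeff.2 (h ▸ isUnit_one)

/-- If `b` is the sum of `u ^ d * a (h + d)` over `d ≥ 0`, then its coefficients are sums of the
coefficients of `a` along antidiagonals. -/
lemma coeff_eq_sum_of_antidiagonal {a b : ℕ → ℤ⟦X⟧} (hb0 : ∀ h, coeff 0 (b h) = 0)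
    (hb : ∀ h, b h = a h + X * b (h + 1)) (m h : ℕ) :
    coeff m (b h) = ∑ i ∈ Finset.range m, coeff (i + 1) (a (h + (m - 1 - i))) := by
  induction m generalizing h with
  | zero => simpa using hb0 h
  | succ m ih =>
    rw [hb, map_add, coeff_succ_X_mul, ih, Finset.sum_range_succ, add_comm]
    congr 1
    · refine Finset.sum_congr rfl fun i hi => ?_
      have := Finset.mem_range.1 hi
      rw [show h + 1 + (m - 1 - i) = h + (m + 1 - 1 - i) by omega]
    · simp

/-- The generating function of `treeCount`. -/
lemma treeCount_eq_coeff {U w g : ℤ⟦X⟧⟦X⟧}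
    (hU : (1 - C X) * (U - 1) = X * (1 - X) * U ^ 2) (hw : (1 - X * U) * w = 1)
    (hg : (1 - C X * w) * g = 1) (n m h : ℕ) :
    (treeCount n (m + 1) h : ℤ) = coeff (m + 1) (coeff n (C (X * mk 1) * U * w ^ h)) := by
  set Y : ℤ⟦X⟧⟦X⟧ := C (X * mk 1) * U with hY
  have hne : (1 - X * U) ≠ 0 := left_ne_zero_of_mul_eq_one hw
  have hne' : (1 - C X * w) ≠ 0 := left_ne_zero_of_mul_eq_one hg
  -- Multiplied by 1 - xU, this is the Catalan equation `hU`.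
  have hkey : U * (1 - X - C X * w) = 1 - C X * w := by
    refine mul_left_cancel₀ hne ?_
    linear_combination hU - C X * (U - 1) * hw
  have h0 : Y = C (X * mk 1) + X * (Y * g) := by
    refine mul_left_cancel₀ hne' ?_
    linear_combination C (X * mk 1) * (hkey - X * U * hg)
  -- This is the difference of the recurrence `hrec` at k + 1 and k, divided by Y w^k.
  have hstep : w * (1 - X) = 1 + X * g * (w - 1) := by
    refine mul_left_cancel₀ hne' ?_
    linear_combination X * w * hkey + (1 - C X * w - X) * hw - X * (w - 1) * hg
  have hrec (k : ℕ) : Y * w ^ k = C (X * mk 1) + X * (Y * w ^ k * g +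
      ∑ i ∈ Finset.range k, Y * w ^ (i + 1)) := by
    induction k with
    | zero => simpa using h0
    | succ k ih =>
      rw [Finset.sum_range_succ]
      linear_combination ih + Y * w ^ k * hstep
  -- As g = 1/(1 - uw), the series Y w^h g is the sum of u^d Y w^(h+d); it accounts for the children
  -- with a new, possibly equal, minimum.
  have hb (n m h : ℕ) : coeff (m + 1) (coeff n (Y * w ^ h * g)) = ∑ i ∈ Finset.range (m + 1),
      coeff (i + 1) (coeff n (Y * w ^ (h + (m + 1 - 1 - i)))) := by
    refine coeff_eq_sum_of_antidiagonal (a := fun h => coeff n (Y * w ^ h))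
      (b := fun h => coeff n (Y * w ^ h * g)) (fun h => ?_) (fun h => ?_) (m + 1) h
    · simp only [hY, mul_assoc, coeff_C_mul, coeff_zero_X_mul]
    · rw [← coeff_C_mul, ← map_add]
      congr 1
      linear_combination Y * w ^ h * hg
  induction n generalizing m h with
  | zero =>
    rw [hrec, map_add, coeff_zero_X_mul, add_zero, coeff_zero_C, coeff_succ_X_mul, coeff_mk]
    simp [treeCount]
  | succ n ih =>
    rw [hrec, map_add, coeff_succ_X_mul, coeff_succ_C, zero_add, map_add, map_add, hb, map_sum,
      map_sum, treeCount]
    push_cast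
    congr 1
    · exact Finset.sum_congr rfl fun i _ => ih _ _
    · exact Finset.sum_congr rfl fun i _ => ih _ _

/-- The binomial (k+j choose j) is the coefficient of u^(k+1) in u/(1-u)^(j+1). -/
theorem treeCount_zero_right (n k : ℕ) :
    (treeCount n (k + 1) 0 : ℤ) = ∑ j ∈ Finset.range (n + 1),
      (-1 : ℤ) ^ (n - j) * catalan j * j.choose (n - j) * (k + j).choose j := by
  obtain ⟨U, hU, hcoeff⟩ := exists_catalan_comp
  obtain ⟨w, hw⟩ := (isUnit_of_constantCoeff_eq_one
    (f := 1 - X * U) (by simp)).exists_right_inv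
  have hw0 : constantCoeff w = 1 := by simpa using congrArg constantCoeff hw
  obtain ⟨g, hg⟩ := (isUnit_iff_constantCoeff.2 (isUnit_of_constantCoeff_eq_one (by simp [hw0])) :
    IsUnit (1 - C X * w)).exists_right_inv
  rw [treeCount_eq_coeff hU hw hg, pow_zero, mul_one, coeff_C_mul, hcoeff, mul_assoc,
    coeff_succ_X_mul, Finset.mul_sum, map_sum]
  refine Finset.sum_congr rfl fun j _ => ?_
  rw [mul_left_comm, ← pow_succ', mk_one_pow_eq_mk_choose_add, ← eq_intCast C, coeff_C_mul,
    coeff_mk, add_comm j k]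
  ring

end WordPattern

/-! ### The diagonal as a hypergeometric sum -/

namespace WordPattern

open Nat

/-- The reciprocal of the factorial, extended by zero to the negative integers. -/
noncomputable def invFactorial (z : ℤ) : ℚ := if z < 0 then 0 else ((z.toNat)! : ℚ)⁻¹

lemma invFactorial_natCast (n : ℕ) : invFactorial n = (n ! : ℚ)⁻¹ := by
  simp [invFactorial]

lemma invFactorial_of_neg {z : ℤ} (hz : z < 0) : invFactorial z = 0 := if_pos hz

/-- Both sides vanish at z = 0, so the shift rule holds for all integers and later identities need
no boundary cases. -/
lemma invFactorial_sub_one (z : ℤ) : invFactorial (z - 1) = z * invFactorial z := by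
  rcases lt_trichotomy z 0 with h | rfl | h
  · rw [invFactorial_of_neg h, invFactorial_of_neg (by omega), mul_zero]
  · rw [invFactorial_of_neg (by omega), Int.cast_zero, zero_mul]
  · obtain ⟨n, rfl⟩ : ∃ n : ℕ, z = (n + 1 : ℕ) := ⟨(z - 1).toNat, by omega⟩
    rw [invFactorial_natCast, show ((n + 1 : ℕ) : ℤ) - 1 = n by push_cast; ring,
      invFactorial_natCast, Nat.factorial_succ]
    have : (n ! : ℚ) ≠ 0 := by positivity
    push_cast
    field_simp

/-- The summand of the formula for the number of words of length `n + 1` on `n + 1` letters. -/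
noncomputable def summand (n j : ℕ) : ℚ :=
  (-1) ^ (n + 1 + j) * (2 * j)! * (n + j)! / (j ! * (j + 1)! * n !) *
    invFactorial (n + 1 - j) * invFactorial (2 * j - n - 1)

lemma summand_of_lt {n j : ℕ} (h : n + 1 < j) : summand n j = 0 := by
  rw [summand, invFactorial_of_neg (z := (n : ℤ) + 1 - j) (by omega), mul_zero, zero_mul]

lemma catalan_eq_factorial_div (j : ℕ) : (catalan j : ℚ) = (2 * j)! / (j ! * (j + 1)!) := by
  have h1 : ((j + 1 : ℕ) : ℚ) * catalan j = (2 * j).choose j := by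
    exact_mod_cast (succ_mul_catalan_eq_centralBinom j).trans (centralBinom_eq_two_mul_choose j)
  rw [Nat.cast_choose ℚ (by omega : j ≤ 2 * j), show 2 * j - j = j by omega] at h1
  rw [factorial_succ]
  have : (j ! : ℚ) ≠ 0 := by positivity
  push_cast at h1 ⊢
  field_simp at h1 ⊢
  linear_combination h1

lemma cast_choose_eq_invFactorial {a b : ℕ} :
    (a.choose b : ℚ) = a ! * invFactorial b * invFactorial (a - b) := by
  rw [invFactorial_natCast]
  rcases le_or_gt b a with h | h
  · rw [← Nat.cast_sub h, invFactorial_natCast, Nat.cast_choose ℚ h]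
    field_simp
  · rw [Nat.choose_eq_zero_of_lt h, invFactorial_of_neg (by omega), mul_zero, Nat.cast_zero]

lemma summand_eq {n j : ℕ} (h : j ≤ n + 1) : summand n j =
    (-1) ^ (n + 1 - j) * catalan j * j.choose (n + 1 - j) * (n + j).choose j := by
  have hs : (-1 : ℚ) ^ (n + 1 + j) = (-1) ^ (n + 1 - j) := by
    rw [show n + 1 + j = n + 1 - j + 2 * j by omega, pow_add, pow_mul]
    simp
  rw [catalan_eq_factorial_div, cast_choose_eq_invFactorial, Nat.cast_choose ℚ (le_add_left j n),
    Nat.add_sub_cancel, summand, hs, Nat.cast_sub h,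
    show (j : ℤ) - (((n + 1 : ℕ) : ℤ) - j) = 2 * j - n - 1 by push_cast; ring]
  have : (j ! : ℚ) ≠ 0 := by positivity
  push_cast
  field_simp

/-- The free upper bound `N` lets three consecutive sums share one range. -/
lemma treeCount_diagonal (n N : ℕ) (hN : n + 2 ≤ N) :
    (treeCount (n + 1) (n + 1) 0 : ℚ) = ∑ j ∈ Finset.range N, summand n j := by
  have h := congrArg (Int.cast : ℤ → ℚ) (treeCount_zero_right (n + 1) n)
  push_cast at h
  rw [h]
  refine (Finset.sum_congr rfl fun j hj => (summand_eq ?_).symm).trans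
    (Finset.sum_subset (Finset.range_subset_range.2 hN) fun j _ hj => summand_of_lt ?_)
  · have := Finset.mem_range.1 hj
    omega
  · have := Finset.mem_range.not.1 hj
    omega

/-! ### Creative telescoping -/

/-- The common hypergeometric factor of the summands at `n`, `n + 1` and `n + 2`. -/
noncomputable def commonFactor (n j : ℕ) : ℚ :=
  (-1) ^ (n + 1 + j) * (2 * j)! * (n + j)! / (j ! * (j + 1)! * (n + 2)!) *
    invFactorial (n + 3 - j) * invFactorial (2 * j - n - 1)

lemma summand_eq_mul_commonFactor (n j : ℕ) : summand n j =
    (n + 1) * (n + 2) * (n + 2 - j) * (n + 3 - j) * commonFactor n j := by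
  have h1 := invFactorial_sub_one ((n : ℤ) + 2 - j)
  have h2 := invFactorial_sub_one ((n : ℤ) + 3 - j)
  rw [show (n : ℤ) + 2 - j - 1 = n + 1 - j by ring] at h1
  rw [show (n : ℤ) + 3 - j - 1 = n + 2 - j by ring] at h2
  rw [summand, commonFactor, h1, h2, factorial_succ (n + 1), factorial_succ n]
  have : (n ! : ℚ) ≠ 0 := by positivity
  push_cast
  field_simp
  ring

lemma summand_succ_eq_mul_commonFactor (n j : ℕ) : summand (n + 1) j =
    -((n + j + 1) * (n + 2) * (n + 3 - j) * (2 * j - n - 1)) * commonFactor n j := by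
  have h1 := invFactorial_sub_one (2 * (j : ℤ) - n - 1)
  have h2 := invFactorial_sub_one ((n : ℤ) + 3 - j)
  rw [show 2 * (j : ℤ) - n - 1 - 1 = 2 * j - (n + 1 : ℕ) - 1 by push_cast; ring] at h1
  rw [show (n : ℤ) + 3 - j - 1 = (n + 1 : ℕ) + 1 - j by push_cast; ring] at h2
  rw [summand, commonFactor, h1, h2, factorial_succ (n + 1), show n + 1 + j = n + j + 1 by ring,
    factorial_succ (n + j), show n + 1 + 1 + j = n + j + 1 + 1 by ring, pow_succ _ (n + j + 1)]
  have : ((n + 1)! : ℚ) ≠ 0 := by positivity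
  push_cast
  field_simp
  ring

lemma summand_add_two_eq_mul_commonFactor (n j : ℕ) : summand (n + 2) j =
    (n + j + 1) * (n + j + 2) * (2 * j - n - 2) * (2 * j - n - 1) * commonFactor n j := by
  have h1 := invFactorial_sub_one (2 * (j : ℤ) - n - 1)
  have h2 := invFactorial_sub_one (2 * (j : ℤ) - n - 2)
  rw [show 2 * (j : ℤ) - n - 1 - 1 = 2 * j - n - 2 by ring] at h1
  rw [show 2 * (j : ℤ) - n - 2 - 1 = 2 * j - (n + 2 : ℕ) - 1 by push_cast; ring] at h2
  rw [summand, commonFactor, h2, h1, show n + 2 + j = n + j + 1 + 1 by ring,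
    factorial_succ (n + j + 1), factorial_succ (n + j),
    show n + 2 + 1 + j = n + 1 + j + 2 by ring, pow_add _ (n + 1 + j),
    show ((n + 2 : ℕ) : ℤ) + 1 - j = n + 3 - j by push_cast; ring]
  push_cast
  field_simp
  ring

lemma commonFactor_succ (n j : ℕ) :
    (j + 2) * (2 * j - n) * (2 * j - n + 1) * commonFactor n (j + 1) =
      -2 * (2 * j + 1) * (n + j + 1) * (n + 3 - j) * commonFactor n j := by
  have h1 := invFactorial_sub_one (2 * (j : ℤ) - n + 1)
  have h2 := invFactorial_sub_one (2 * (j : ℤ) - n)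
  have h3 := invFactorial_sub_one ((n : ℤ) + 3 - j)
  rw [show 2 * (j : ℤ) - n + 1 - 1 = 2 * j - n by ring] at h1
  rw [h1] at h2
  rw [commonFactor, commonFactor, h2, show (n : ℤ) + 3 - (j + 1 : ℕ) = n + 3 - j - 1 by
    push_cast; ring, h3, show 2 * ((j + 1 : ℕ) : ℤ) - n - 1 = 2 * j - n + 1 by push_cast; ring,
    show 2 * (j + 1) = 2 * j + 1 + 1 by ring, factorial_succ (2 * j + 1), factorial_succ (2 * j),
    ← add_assoc n j 1, factorial_succ (n + j), factorial_succ (j + 1), factorial_succ j,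
    show n + 1 + (j + 1) = n + 1 + j + 1 by ring, pow_succ _ (n + 1 + j)]
  have : (j ! : ℚ) ≠ 0 := by positivity
  have : ((n + 2)! : ℚ) ≠ 0 := by positivity
  push_cast
  field_simp
  ring

/-- The polynomial part of the certificate for creative telescoping. -/
def certificate (n j : ℚ) : ℚ :=
  45 * n ^ 5 - 212 * n ^ 4 + 367 * n ^ 3 - 288 * n ^ 2 + 96 * n
    + j * (-50 * n ^ 5 + 275 * n ^ 4 - 602 * n ^ 3 + 673 * n ^ 2 - 368 * n + 48)
    + j ^ 2 * (10 * n ^ 4 - 28 * n ^ 3 - 2 * n ^ 2 + 36 * n)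

theorem treeCount_diagonal_recurrence (n : ℕ) {x : ℚ} (hx : x = n + 3) :
    (3 * (x - 3) * (x - 1) * (3 * x - 5) * (3 * x - 4) * (5 * x - 4)) *
        (treeCount (n + 1) (n + 1) 0 : ℚ)
      + (288 - 1440 * x + 2780 * x ^ 2 - 2435 * x ^ 3 + 976 * x ^ 4 - 145 * x ^ 5) *
        (treeCount (n + 2) (n + 2) 0 : ℚ)
      + (2 * (x - 2) ^ 2 * x * (x + 1) * (5 * x - 9)) * (treeCount (n + 3) (n + 3) 0 : ℚ) = 0 := by
  -- The linear factors make `commonFactor_succ` express H(j+1) through `commonFactor n j`.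
  set H : ℕ → ℚ := fun j =>
    commonFactor n j * (j + 1) * (2 * j - n - 2) * (2 * j - n - 1) * certificate x j with hH
  rw [treeCount_diagonal n (n + 4) (by omega), treeCount_diagonal (n + 1) (n + 4) (by omega),
    treeCount_diagonal (n + 2) (n + 4) (by omega), Finset.mul_sum, Finset.mul_sum, Finset.mul_sum,
    ← Finset.sum_add_distrib, ← Finset.sum_add_distrib]
  calc _ = ∑ j ∈ Finset.range (n + 4), (H (j + 1) - H j) := by
        refine Finset.sum_congr rfl fun j _ => ?_
        rw [summand_eq_mul_commonFactor, summand_succ_eq_mul_commonFactor,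
          summand_add_two_eq_mul_commonFactor]
        simp only [hH]
        subst hx
        have := congrArg (certificate (n + 3) (j + 1) * ·) (commonFactor_succ n j)
        simp only [certificate] at this ⊢
        push_cast
        linear_combination -this
    _ = 0 := by
        -- The reciprocal factorials of -n-1 (at j = 0) and of -1 (at j = n+4) vanish.
        have h0 : commonFactor n 0 = 0 := by
          rw [commonFactor, invFactorial_of_neg (z := 2 * ((0 : ℕ) : ℤ) - n - 1) (by omega),
            mul_zero]
        have h1 : commonFactor n (n + 4) = 0 := by
          rw [commonFactor, invFactorial_of_neg (z := (n : ℤ) + 3 - (n + 4 : ℕ)) (by omega),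
            mul_zero, zero_mul]
        rw [Finset.sum_range_sub, hH]
        simp only [h0, h1, zero_mul, sub_zero]

end WordPattern

/-! ### The theorem -/

namespace WordPattern

lemma diagonalCount_eq_treeCount (σ : Equiv.Perm (Fin 3)) (n : ℕ) :
    diagonalCount (⇑σ) n = treeCount n n 0 :=
  ncard_avoiders_perm σ n n

lemma diagonalCount_recurrence (σ : Equiv.Perm (Fin 3)) (n : ℕ) {x : ℚ}
    (hx : x = n + 3) :
    (3 * (x - 3) * (x - 1) * (3 * x - 5) * (3 * x - 4) * (5 * x - 4)) *
        (diagonalCount (⇑σ) (n + 1) : ℚ)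
      + (288 - 1440 * x + 2780 * x ^ 2 - 2435 * x ^ 3 + 976 * x ^ 4 - 145 * x ^ 5) *
        (diagonalCount (⇑σ) (n + 2) : ℚ)
      + (2 * (x - 2) ^ 2 * x * (x + 1) * (5 * x - 9)) *
        (diagonalCount (⇑σ) (n + 3) : ℚ) = 0 := by
  simp only [diagonalCount_eq_treeCount]
  exact treeCount_diagonal_recurrence n hx

end WordPattern

theorem theorem4p8 (σ : Equiv.Perm (Fin 3)) :
    WordPattern.IsPRecursive (fun n : ℕ => (WordPattern.diagonalCount (⇑σ) n : ℚ)) ∧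
    ∀ n : ℕ, 3 ≤ n →
      (3 * ((n : ℤ) - 3) * ((n : ℤ) - 1) * (3 * (n : ℤ) - 5) * (3 * (n : ℤ) - 4)
            * (5 * (n : ℤ) - 4)) * (WordPattern.diagonalCount (⇑σ) (n - 2) : ℤ)
        + (288 - 1440 * (n : ℤ) + 2780 * (n : ℤ) ^ 2 - 2435 * (n : ℤ) ^ 3
            + 976 * (n : ℤ) ^ 4 - 145 * (n : ℤ) ^ 5)
            * (WordPattern.diagonalCount (⇑σ) (n - 1) : ℤ)
        + (2 * ((n : ℤ) - 2) ^ 2 * (n : ℤ) * ((n : ℤ) + 1) * (5 * (n : ℤ) - 9))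
            * (WordPattern.diagonalCount (⇑σ) n : ℤ) = 0 := by
  constructor
  · let x : Polynomial ℚ := Polynomial.X + 3
    -- The recurrence links f(n+1), f(n+2), f(n+3) with x = n+3, so f(n) gets coefficient 0.
    refine ⟨3, ![0, 3 * (x - 3) * (x - 1) * (3 * x - 5) * (3 * x - 4) * (5 * x - 4),
      288 - 1440 * x + 2780 * x ^ 2 - 2435 * x ^ 3 + 976 * x ^ 4 - 145 * x ^ 5,
      2 * (x - 2) ^ 2 * x * (x + 1) * (5 * x - 9)], ⟨3, fun h => ?_⟩, fun n => ?_⟩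
    -- At 0 one has x = 3, and the leading coefficient is 144.
    · have := congrArg (Polynomial.eval 0)
        (show 2 * (x - 2) ^ 2 * x * (x + 1) * (5 * x - 9) = 0 from h)
      norm_num [x] at this
    · have := WordPattern.diagonalCount_recurrence σ n rfl
      refine (Fin.sum_univ_four _).trans ?_
      simpa [x] using this
  · intro n hn
    obtain ⟨n, rfl⟩ := Nat.exists_eq_add_of_le' hn
    have := WordPattern.diagonalCount_recurrence σ n rfl
    rw [show n + 3 - 2 = n + 1 by omega, show n + 3 - 1 = n + 2 by omega]
    exact_mod_cast this
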